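/- Let $\mathbb{R}_{\max}=\mathbb{R}\cup\{-\infty\}$ (with $-\infty+a=a+(-\infty)=-\infty$), let $n\ge 1$, let $A\in\mathbb{R}^{n\times n}$, let $p\in\{1,\dots,n\}$ and $\omega=p/n$. For $x\in\mathbb{R}^n$ let $A\otimes_\omega x\in\mathbb{R}^n$ be the vector whose $i$-th entry is the $p$-th smallest (that is, $\lceil \omega n\rceil$-th smallest, counted with multiplicity) of the numbers $A(i,1)+x_1,\dots,A(i,n)+x_n$; a real number $\lambda$ is a maxmin-$\omega$ eigenvalue of $A$ if $A\otimes_\omega x=\lambda+x$ for some $x\in\mathbb{R}^n$. Let $f^{(p)}\colon\mathbb{R}_{\max}^n\to\mathbb{R}_{\max}^n$ be given by $$f^{(p)}(x)_i=\min_{C\subseteq\{1,\dots,n\},\ |C|=p}\ \max_{j\in C}\,\bigl(A(i,j)+x_j\bigr),\qquad i=1,\dots,n.$$ For $x\in\mathbb{R}_{\max}^n$ let $\operatorname{supp}(x)=\{i: x_i\neq-\infty\}$. An eigenvector of $f^{(p)}$ with eigenvalue $\lambda\in\mathbb{R}_{\max}$ is an $x\in\mathbb{R}_{\max}^n$ with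 $\operatorname{supp}(x)\neq\emptyset$ and $f^{(p)}(x)=\lambda+x$. Then: (i) every eigenvector $x$ of $f^{(p)}$ with a finite eigenvalue has full support, that is, $x\in\mathbb{R}^n$; (ii) $f^{(p)}$ has exactly one finite eigenvalue $\lambda_p$. Moreover, $A$ has exactly one maxmin-$\omega$ eigenvalue, and it is $\lambda_p$. -/

import Mathlib

/-- The max-plus semiring `ℝ ∪ {-∞}`: the bottom element is `-∞`, the tropical sum is `max`, and
the tropical product is the usual sum, with `-∞ + a = a + -∞ = -∞`. -/
abbrev RMax : Type := WithBot ℝ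

/-- The maxmin-`ω` operation on a finite multiset `S` of reals with `m` elements: the
`⌈ω m⌉`-th smallest element of `S`, counted with multiplicity (meaningful for `0 < ω ≤ 1`
and `S` nonempty; the list of the sorted elements is indexed from zero). -/
noncomputable def maxminOp (ω : ℝ) (S : Multiset ℝ) : ℝ :=
  (S.sort (· ≤ ·)).getD (⌈ω * (Multiset.card S : ℝ)⌉₊ - 1) 0

/-- The maxmin-`ω` matrix-vector product `A ⊗_ω x`: its `i`-th entry is the maxmin-`ω` operation
applied to the multiset of the numbers `A i j + x j`, for `j` in the index set. -/
noncomputable def maxminMulVec {n : ℕ} (ω : ℝ) (A : Matrix (Fin n) (Fin n) ℝ)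
    (x : Fin n → ℝ) : Fin n → ℝ :=
  fun i => maxminOp ω ((Finset.univ : Finset (Fin n)).val.map fun j => A i j + x j)

/-- `lam` is a maxmin-`ω` eigenvalue of the real matrix `A`: there is a real vector `x` with
`A ⊗_ω x = lam + x`. -/
def IsMaxminEigenvalue {n : ℕ} (ω : ℝ) (A : Matrix (Fin n) (Fin n) ℝ) (lam : ℝ) : Prop :=
  ∃ x : Fin n → ℝ, maxminMulVec ω A x = fun i => lam + x i

/-- The map `f^(p) : RMax^n → RMax^n`,
`f^(p)(x)_i = min_{C ⊆ [n], |C| = p} max_{j ∈ C} (A i j + x j)`. -/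
noncomputable def maxminMap {n : ℕ} (A : Matrix (Fin n) (Fin n) ℝ) (p : ℕ) (hp : p ≤ n)
    (x : Fin n → RMax) : Fin n → RMax :=
  fun i =>
    (Finset.powersetCard p (Finset.univ : Finset (Fin n))).inf'
      (Finset.powersetCard_nonempty.2 (by simpa using hp))
      (fun C => C.sup fun j => ((A i j : ℝ) : RMax) + x j)

/-- The support of a max-plus vector. -/
def maxPlusSupport {n : ℕ} (x : Fin n → RMax) : Set (Fin n) := {i | x i ≠ ⊥}

/-- `x` is an eigenvector of the self-map `f` of `RMax^n` with eigenvalue `lam`: its support is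
nonempty and `f x = lam + x`. -/
def IsMaxPlusEigenvector {n : ℕ} (f : (Fin n → RMax) → (Fin n → RMax)) (lam : RMax)
    (x : Fin n → RMax) : Prop :=
  (maxPlusSupport x).Nonempty ∧ f x = fun i => lam + x i

/-- `lam` is an eigenvalue of the self-map `f` of `RMax^n`. -/
def IsMaxPlusEigenvalue {n : ℕ} (f : (Fin n → RMax) → (Fin n → RMax)) (lam : RMax) : Prop :=
  ∃ x : Fin n → RMax, IsMaxPlusEigenvector f lam x

/-!
The `p`-th smallest of the numbers `A i j + x j` is at most `t` exactly when at least `p` of them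
are at most `t`. Both the map `f^(p)` (`maxminMap_le_iff`) and the product `A ⊗_ω x` with `ω = p / n`
(`maxminMulVec_le_iff`) satisfy this description, so they agree on real vectors
(`maxminMap_coe`), and every property used below is read off from the count.

*Full support.* `f^(p)(x)_i = -∞` means that at least `p` entries of `x` are `-∞`, a condition that
does not depend on `i`. If `f^(p)(x) = lam + x` with `lam` finite, the entries of `x` are
therefore all finite or all `-∞`, and the second case is excluded by the nonempty support.

*Uniqueness.* The real map is monotone and commutes with the addition of constants. Comparing two
eigenvectors `x` and `y` at an index where `y - x` is maximal bounds one eigenvalue by the other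
(`eigenvalue_le_of_monotone_of_add_const`).

*Existence.* Changing the row `i` changes the numbers `A i j + x j` by a bounded amount, so the
coordinates of `A ⊗_ω x` differ from each other by at most a constant independent of `x`. A map `f`
that is monotone, commutes with constants and has such a bounded oscillation has an eigenvector
(`exists_eigenvector_of_bounded_oscillation`): `f` is nonexpansive for the sup norm, so for `a < 1`
the discounted map `x ↦ f (a x)` is a contraction. Its fixed points, normalised to vanish at one
coordinate, stay in a fixed ball, and a limit point as `a → 1` is an eigenvector.
-/

/-! ### Order statistics by counting -/

/-- In a sorted list, the entries at most `t` form an initial segment, so the entry of (zero-based)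
index `k` is at most `t` exactly when at least `k + 1` entries are. -/
theorem List.getElem_le_iff_succ_le_countP {l : List ℝ} (hl : l.Pairwise (· ≤ ·)) (t : ℝ) (k : ℕ)
    (hk : k < l.length) : l[k] ≤ t ↔ k + 1 ≤ l.countP (· ≤ t) := by
  induction l generalizing k with
  | nil => simp at hk
  | cons a l ih =>
    rw [List.pairwise_cons] at hl
    by_cases ha : a ≤ t
    · cases k with
      | zero => simp [ha]
      | succ k =>
        have := ih hl.2 k (by simpa using hk)
        simp [ha, this]
    · -- The head is the least element, so nothing is counted.
      have h0 : (a :: l).countP (· ≤ t) = 0 := by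
        rw [List.countP_eq_zero]
        intro b hb
        rcases List.mem_cons.1 hb with rfl | hb
        · simpa using ha
        · simpa using (not_le.1 ha).trans_le (hl.1 b hb)
      rw [h0]
      have : ¬ (a :: l)[k] ≤ t := by
        cases k with
        | zero => simpa using ha
        | succ k =>
          have hm : l[k]'(by simpa using hk) ∈ l := List.getElem_mem _
          simpa using (not_le.1 ha).trans_le (hl.1 _ hm)
      simp [this]

theorem maxminMulVec_le_iff {n p : ℕ} (hp1 : 1 ≤ p) (hpn : p ≤ n) (A : Matrix (Fin n) (Fin n) ℝ)
    (x : Fin n → ℝ) (i : Fin n) (t : ℝ) :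
    maxminMulVec ((p : ℝ) / n) A x i ≤ t ↔
      p ≤ (Finset.univ.filter fun j => A i j + x j ≤ t).card := by
  have hn : (n : ℝ) ≠ 0 := by
    have : n ≠ 0 := by omega
    exact_mod_cast this
  set S : Multiset ℝ := (Finset.univ : Finset (Fin n)).val.map fun j => A i j + x j with hS
  have hc : Multiset.card S = n := by simp [hS]
  have hlen : (S.sort (· ≤ ·)).length = n := by rw [Multiset.length_sort, hc]
  have hk : p - 1 < (S.sort (· ≤ ·)).length := by omega
  have hval : maxminMulVec ((p : ℝ) / n) A x i = (S.sort (· ≤ ·))[p - 1] := by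
    simp only [maxminMulVec, maxminOp, ← hS, hc, div_mul_cancel₀ _ hn, Nat.ceil_natCast]
    rw [List.getD_eq_getElem _ _ hk]
  have hcount : (S.sort (· ≤ ·)).countP (· ≤ t) =
      (Finset.univ.filter fun j => A i j + x j ≤ t).card := by
    rw [← Multiset.coe_countP, Multiset.sort_eq, hS, Multiset.countP_map]
    rfl
  rw [hval, List.getElem_le_iff_succ_le_countP (Multiset.pairwise_sort S _) t (p - 1) hk, hcount,
    Nat.sub_add_cancel hp1]

theorem maxminMap_le_iff {n p : ℕ} (hpn : p ≤ n) (A : Matrix (Fin n) (Fin n) ℝ)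
    (x : Fin n → RMax) (i : Fin n) (t : RMax) :
    maxminMap A p hpn x i ≤ t ↔
      p ≤ (Finset.univ.filter fun j => ((A i j : ℝ) : RMax) + x j ≤ t).card := by
  rw [maxminMap, Finset.inf'_le_iff]
  constructor
  · rintro ⟨C, hC, h⟩
    rw [Finset.sup_le_iff] at h
    rw [← (Finset.mem_powersetCard.1 hC).2]
    exact Finset.card_le_card fun j hj => by simpa using h j hj
  · intro h
    obtain ⟨C, hCs, hC⟩ := Finset.exists_subset_card_eq h
    refine ⟨C, Finset.mem_powersetCard.2 ⟨Finset.subset_univ _, hC⟩, Finset.sup_le fun j hj => ?_⟩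
    simpa using hCs hj

theorem maxminMap_coe {n p : ℕ} (hp1 : 1 ≤ p) (hpn : p ≤ n) (A : Matrix (Fin n) (Fin n) ℝ)
    (x : Fin n → ℝ) (i : Fin n) :
    maxminMap A p hpn (fun j => (x j : RMax)) i =
      ((maxminMulVec ((p : ℝ) / n) A x i : ℝ) : RMax) := by
  have key : ∀ t : ℝ, maxminMap A p hpn (fun j => (x j : RMax)) i ≤ (t : RMax) ↔
      maxminMulVec ((p : ℝ) / n) A x i ≤ t := fun t => by
    rw [maxminMap_le_iff, maxminMulVec_le_iff hp1 hpn]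
    simp only [← WithBot.coe_add, WithBot.coe_le_coe]
  generalize maxminMap A p hpn (fun j => (x j : RMax)) i = a at key
  generalize maxminMulVec ((p : ℝ) / n) A x i = r at key
  induction a using WithBot.recBotCoe with
  | bot => linarith [(key (r - 1)).1 bot_le]
  | coe a =>
    simp only [WithBot.coe_le_coe] at key
    exact congrArg _ (le_antisymm ((key r).2 le_rfl) ((key a).1 le_rfl))

/-! ### The real map: monotonicity, homogeneity, bounded oscillation -/

theorem maxminMulVec_mono {n p : ℕ} (hp1 : 1 ≤ p) (hpn : p ≤ n) (A : Matrix (Fin n) (Fin n) ℝ) :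
    Monotone (maxminMulVec ((p : ℝ) / n) A) := fun x y hxy i => by
  rw [maxminMulVec_le_iff hp1 hpn]
  refine ((maxminMulVec_le_iff hp1 hpn A y i _).1 le_rfl).trans (Finset.card_le_card fun j => ?_)
  simp only [Finset.mem_filter, Finset.mem_univ, true_and]
  have := hxy j
  intro h
  linarith

theorem maxminMulVec_add_const {n p : ℕ} (hp1 : 1 ≤ p) (hpn : p ≤ n)
    (A : Matrix (Fin n) (Fin n) ℝ) (x : Fin n → ℝ) (c : ℝ) (i : Fin n) :
    maxminMulVec ((p : ℝ) / n) A (fun j => x j + c) i = maxminMulVec ((p : ℝ) / n) A x i + c := by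
  refine eq_of_forall_ge_iff fun t => ?_
  rw [← le_sub_iff_add_le, maxminMulVec_le_iff hp1 hpn, maxminMulVec_le_iff hp1 hpn]
  simp only [← add_assoc, le_sub_iff_add_le]

/-- The numbers `A i k + x k` and `A j k + x k` differ by `A i k - A j k`, which is bounded
independently of `x`; so do their order statistics. -/
theorem exists_maxminMulVec_oscillation_le {n p : ℕ} (hp1 : 1 ≤ p) (hpn : p ≤ n)
    (A : Matrix (Fin n) (Fin n) ℝ) :
    ∃ D : ℝ, ∀ x i j,
      maxminMulVec ((p : ℝ) / n) A x i ≤ maxminMulVec ((p : ℝ) / n) A x j + D := by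
  obtain ⟨D, hD⟩ := (Set.finite_range
    fun q : Fin n × Fin n × Fin n => A q.1 q.2.2 - A q.2.1 q.2.2).bddAbove
  refine ⟨D, fun x i j => ?_⟩
  rw [maxminMulVec_le_iff hp1 hpn]
  refine ((maxminMulVec_le_iff hp1 hpn A x j _).1 le_rfl).trans (Finset.card_le_card fun k => ?_)
  simp only [Finset.mem_filter, Finset.mem_univ, true_and]
  have : A i k - A j k ≤ D := hD ⟨(i, j, k), rfl⟩
  intro h
  linarith

/-! ### Eigenvectors of monotone additively homogeneous maps -/

theorem eigenvalue_le_of_monotone_of_add_const {ι : Type*} [Finite ι] [Nonempty ι]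
    {f : (ι → ℝ) → ι → ℝ} (hf : Monotone f) (hc : ∀ x c i, f (fun j => x j + c) i = f x i + c)
    {x y : ι → ℝ} {lam mu : ℝ} (hx : f x = fun i => lam + x i) (hy : f y = fun i => mu + y i) :
    mu ≤ lam := by
  obtain ⟨i, hi⟩ := Finite.exists_max fun i => y i - x i
  have h : f y i ≤ f (fun j => x j + (y i - x i)) i := hf (fun j => by linarith [hi j]) i
  rw [hc, hx, hy] at h
  linarith

theorem lipschitzWith_one_of_monotone_of_add_const {ι : Type*} [Fintype ι]
    {f : (ι → ℝ) → ι → ℝ} (hf : Monotone f) (hc : ∀ x c i, f (fun j => x j + c) i = f x i + c) :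
    LipschitzWith 1 f := by
  have key : ∀ x y i, f x i ≤ f y i + dist x y := fun x y i => by
    rw [← hc]
    refine hf (fun j => ?_) i
    have := (le_abs_self _).trans ((Real.dist_eq (x j) (y j)).symm.le.trans (dist_le_pi_dist x y j))
    linarith
  refine LipschitzWith.of_dist_le_mul fun x y => ?_
  rw [NNReal.coe_one, one_mul, dist_pi_le_iff dist_nonneg]
  intro i
  rw [Real.dist_eq, abs_sub_le_iff]
  have h1 := key x y i
  have h2 := key y x i
  rw [dist_comm y x] at h2
  constructor <;> linarith

/-- Existence by the vanishing discount method: as `a → 1`, normalised fixed points of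
`x ↦ f (a x)` accumulate at an eigenvector. -/
theorem exists_eigenvector_of_bounded_oscillation {ι : Type*} [Fintype ι] [Nonempty ι]
    {f : (ι → ℝ) → ι → ℝ} (hf : Monotone f) (hc : ∀ x c i, f (fun j => x j + c) i = f x i + c)
    {D : ℝ} (hD : ∀ x i j, f x i ≤ f x j + D) :
    ∃ (lam : ℝ) (x : ι → ℝ), f x = fun i => lam + x i := by
  have hL := lipschitzWith_one_of_monotone_of_add_const hf hc
  obtain ⟨i₀⟩ := ‹Nonempty ι›
  have hD0 : 0 ≤ D := by linarith [hD 0 i₀ i₀]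
  -- The fixed point `x = f (a x)`, shifted by `x i₀`; the eigenvalue of the discounted equation
  -- is then `f (a y) i₀`, because `y i₀ = 0`.
  have hdisc : ∀ a : NNReal, a < 1 → ∃ y ∈ Metric.closedBall (0 : ι → ℝ) D,
      ∀ i, f ((a : ℝ) • y) i = f ((a : ℝ) • y) i₀ + y i := by
    intro a ha
    have hg : ContractingWith a fun x : ι → ℝ => f ((a : ℝ) • x) := by
      refine ⟨ha, LipschitzWith.of_dist_le_mul fun x y => ?_⟩
      refine (hL.dist_le_mul _ _).trans ?_
      rw [NNReal.coe_one, one_mul, dist_smul₀, Real.norm_of_nonneg a.coe_nonneg]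
    set x := ContractingWith.fixedPoint _ hg
    have hx : f ((a : ℝ) • x) = x := hg.fixedPoint_isFixedPt
    have hy : ∀ i, f ((a : ℝ) • fun j => x j - x i₀) i = x i - a * x i₀ := fun i => by
      have h := hc ((a : ℝ) • x) (-(a * x i₀)) i
      rw [hx] at h
      rw [sub_eq_add_neg, ← h]
      congr 1
      ext j
      simp only [Pi.smul_apply, smul_eq_mul]
      ring
    refine ⟨fun j => x j - x i₀, ?_, fun i => ?_⟩
    · rw [mem_closedBall_zero_iff, pi_norm_le_iff_of_nonneg hD0]
      intro i
      have h1 := hD ((a : ℝ) • x) i i₀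
      have h2 := hD ((a : ℝ) • x) i₀ i
      rw [hx] at h1 h2
      rw [Real.norm_eq_abs, abs_sub_le_iff]
      constructor <;> linarith
    · rw [hy, hy]
      ring
  obtain ⟨a, -, ha, hlim⟩ := exists_seq_strictMono_tendsto' (zero_lt_one : (0 : NNReal) < 1)
  choose y hyD hy using fun k => hdisc (a k) (ha k).2
  obtain ⟨z, -, φ, hφ, hz⟩ := (isCompact_closedBall (0 : ι → ℝ) D).tendsto_subseq hyD
  have hlim' : Filter.Tendsto (fun k => (a (φ k) : ℝ) • y (φ k)) Filter.atTop (nhds z) := by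
    have h1 : Filter.Tendsto (fun k => (a (φ k) : ℝ)) Filter.atTop (nhds 1) :=
      (NNReal.tendsto_coe.2 hlim).comp hφ.tendsto_atTop
    simpa using h1.smul hz
  have hfz := (hL.continuous.tendsto z).comp hlim'
  refine ⟨f z i₀, z, funext fun i => ?_⟩
  refine tendsto_nhds_unique (tendsto_pi_nhds.1 hfz i) ?_
  refine ((tendsto_pi_nhds.1 hfz i₀).add (tendsto_pi_nhds.1 hz i)).congr fun k => ?_
  exact (hy (φ k) i).symm

/-! ### Eigenvectors over the max-plus semiring -/

theorem maxPlusSupport_eq_univ {n p : ℕ} (hpn : p ≤ n) (A : Matrix (Fin n) (Fin n) ℝ)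
    {lam : RMax} {x : Fin n → RMax} (hlam : lam ≠ ⊥)
    (hx : IsMaxPlusEigenvector (maxminMap A p hpn) lam x) : maxPlusSupport x = Set.univ := by
  have key : ∀ i, x i = ⊥ ↔ p ≤ (Finset.univ.filter fun j => x j = ⊥).card := fun i => by
    have h := maxminMap_le_iff hpn A x i ⊥
    rw [hx.2] at h
    simpa [hlam] using h
  obtain ⟨k, hk⟩ := hx.1
  exact Set.eq_univ_of_forall fun i hi => hk ((key k).2 ((key i).1 hi))

theorem isMaxPlusEigenvalue_maxminMap_coe_iff {n p : ℕ} (hp1 : 1 ≤ p) (hpn : p ≤ n)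
    (A : Matrix (Fin n) (Fin n) ℝ) (mu : ℝ) :
    IsMaxPlusEigenvalue (maxminMap A p hpn) (mu : RMax) ↔
      IsMaxminEigenvalue ((p : ℝ) / n) A mu := by
  constructor
  · rintro ⟨x, hx⟩
    have hsupp := maxPlusSupport_eq_univ hpn A WithBot.coe_ne_bot hx
    have hfin : ∀ i, ∃ r : ℝ, (r : RMax) = x i := fun i =>
      WithBot.ne_bot_iff_exists.1 (hsupp.symm ▸ Set.mem_univ i : i ∈ maxPlusSupport x)
    choose y hy using hfin
    obtain rfl : (fun i => (y i : RMax)) = x := funext hy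
    refine ⟨y, funext fun i => ?_⟩
    have h := congrFun hx.2 i
    rw [maxminMap_coe hp1] at h
    exact WithBot.coe_injective (h.trans (WithBot.coe_add _ _).symm)
  · rintro ⟨y, hy⟩
    refine ⟨fun i => (y i : RMax), ⟨⟨0, by omega⟩, WithBot.coe_ne_bot⟩, funext fun i => ?_⟩
    rw [maxminMap_coe hp1, hy, WithBot.coe_add]

/-- Every eigenvector of `f^(p)` with a finite eigenvalue has full support; there is a real
number `lam` which is the one and only finite eigenvalue of `f^(p)` and the one and only
maxmin-`p/n` eigenvalue of `A`. -/
theorem propositionp (n p : ℕ) (hp1 : 1 ≤ p) (hpn : p ≤ n) (A : Matrix (Fin n) (Fin n) ℝ) :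
    (∀ (lam : RMax) (x : Fin n → RMax), lam ≠ ⊥ →
        IsMaxPlusEigenvector (maxminMap A p hpn) lam x → maxPlusSupport x = Set.univ) ∧
    (∃ lam : ℝ,
        (∀ mu : RMax, (mu ≠ ⊥ ∧ IsMaxPlusEigenvalue (maxminMap A p hpn) mu) ↔ mu = (lam : RMax)) ∧
        (∀ mu : ℝ, IsMaxminEigenvalue ((p : ℝ) / (n : ℝ)) A mu ↔ mu = lam)) := by

  have : Nonempty (Fin n) := ⟨⟨0, by omega⟩⟩
  have hmono := maxminMulVec_mono hp1 hpn A
  have hconst := maxminMulVec_add_const hp1 hpn A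
  refine ⟨fun lam x hlam hx => maxPlusSupport_eq_univ hpn A hlam hx, ?_⟩
  obtain ⟨D, hD⟩ := exists_maxminMulVec_oscillation_le hp1 hpn A
  obtain ⟨lam, x, hx⟩ := exists_eigenvector_of_bounded_oscillation hmono hconst hD
  have hreal : ∀ mu : ℝ, IsMaxminEigenvalue ((p : ℝ) / (n : ℝ)) A mu ↔ mu = lam := by
    refine fun mu => ⟨?_, ?_⟩
    · rintro ⟨y, hy⟩
      exact le_antisymm (eigenvalue_le_of_monotone_of_add_const hmono hconst hx hy)
        (eigenvalue_le_of_monotone_of_add_const hmono hconst hy hx)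
    · rintro rfl
      exact ⟨x, hx⟩
  refine ⟨lam, fun mu => ?_, hreal⟩
  induction mu using WithBot.recBotCoe with
  | bot => simp
  | coe mu => simp [isMaxPlusEigenvalue_maxminMap_coe_iff hp1 hpn A, hreal]
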